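/- Let $S(n,k)$ denote the Stirling numbers of the second kind. For $n=0,1,2,\dots$ and real $r>0$ put $$\omega_n(x)=\sum_{k=0}^{n}S(n,k)\,k!\,x^k,\qquad \omega_{n,r}(x)=\frac{1}{\Gamma(r)}\sum_{k=0}^{n}S(n,k)\,\Gamma(k+r)\,x^k .$$ For real $a$, $\int_{a-i\infty}^{a+i\infty}$ denotes integration along the vertical line $s=a+it$, $-\infty<t<\infty$. All the integrals below converge absolutely, and the following identities hold. 1. For every real $r\ge 0$, every $0<x<1$, every $n=0,1,2,\dots$ and every $0<a<1$, $$\frac{1}{(1+x)^{r+1}}\,\omega_{n,r+1}\!\left(\frac{-x}{1+x}\right)=\frac{(-1)^n}{2\pi i\,\Gamma(r+1)}\int_{a-i\infty}^{a+i\infty}x^{-s}s^n\,\Gamma(s)\,\Gamma(r+1-s)\,ds .$$ 2. For every $x>0$, every $n=0,1,2,\dots$ and every $a>n+1$, $$\frac{e^x}{e^x-1}\,\omega_n\!\left(\frac{1}{e^x-1}\right)=\delta_{n,0}+\frac{1}{2\pi i}\int_{a-i\infty}^{a+i\infty}x^{-s}\zeta(s-n)\,\Gamma(s)\,ds ,$$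 where $\zeta$ is the Riemann zeta function, $\delta_{0,0}=1$ and $\delta_{n,0}=0$ for $n\ge 1$. 3. For every $x>0$ and every $n=1,2,3,\dots$, $$\frac{e^x}{e^x+1}\,\omega_n\!\left(\frac{-1}{e^x+1}\right)=(-1)^n\int_0^\infty \sin\!\left(xt+\frac{\pi n}{2}\right)\frac{t^n}{\sinh(\pi t)}\,dt .$$ 4. For every $x>0$ and every $n=1,2,3,\dots$, $$\frac{e^x}{e^x-1}\,\omega_n\!\left(\frac{1}{e^x-1}\right)=\frac{n!}{x^{n+1}}+2(-1)^n\int_0^\infty \sin\!\left(xt+\frac{\pi n}{2}\right)\frac{t^n}{e^{2\pi t}-1}\,dt .$$ -/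

import Mathlib

open MeasureTheory Set

noncomputable section

/-- The geometric polynomial `ω_n(x) = ∑_{k=0}^n S(n,k) k! x^k`. -/
def geomPoly (n : ℕ) (x : ℝ) : ℝ :=
  ∑ k ∈ Finset.range (n + 1), (Nat.stirlingSecond n k : ℝ) * (Nat.factorial k : ℝ) * x ^ k

/-- The generalized geometric polynomial
`ω_{n,r}(x) = Γ(r)⁻¹ ∑_{k=0}^n S(n,k) Γ(k+r) x^k`, for real `r > 0`. -/
def genGeomPoly (n : ℕ) (r x : ℝ) : ℝ :=
  1 / Real.Gamma r *
    ∑ k ∈ Finset.range (n + 1), (Nat.stirlingSecond n k : ℝ) * Real.Gamma (k + r) * x ^ k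

/-- The contour integral `∫_{a-i∞}^{a+i∞} F(s) ds` along `s = a + it`, `ds = i dt`. -/
def vertLineIntegral (a : ℝ) (F : ℂ → ℂ) : ℂ :=
  Complex.I * ∫ t : ℝ, F ((a : ℂ) + (t : ℂ) * Complex.I)

end

/-!
Expanding `m ^ n` in falling factorials turns the geometric series into
`∑ m ^ n * z ^ m = (1 - z)⁻¹ * ω_n (z / (1 - z))`. With `z = e⁻ˣ` the left side, without its `m = 0`
term, has Mellin transform `ζ(s - n) Γ(s)`, and `(1 + x)^(-r) * ω_{n,r}(-x / (1 + x))` has Mellin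
transform `(-s)^n * Γ(s) Γ(r - s) / Γ(r)` by the Beta integral; the contour integrals are the two
Mellin inversions. With `z = ± e⁻ˣ`, Lipschitz's formula rewrites the left side as a sum of
`n! / (x ± i c) ^ (n + 1)` over conjugate pairs, `c` running through the odd or the even multiples
of `π`. Each pair is a Laplace transform of `t ^ n * sin (x t + π n / 2)` evaluated at `c`, and
summing the geometric series `∑ e⁻ᶜᵗ` gives the kernels `1 / sinh (π t)` and `1 / (e^(2πt) - 1)`.
-/

section PowerSeries

theorem pow_eq_sum_stirlingSecond_mul_descPochhammer {R : Type*} [CommRing R] (n : ℕ) (x : R) :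
    x ^ n = ∑ k ∈ Finset.range (n + 1),
      (Nat.stirlingSecond n k : R) * (descPochhammer R k).eval x := by
  induction n with
  | zero => simp
  | succ n ih =>
    have shift : ∑ k ∈ Finset.range (n + 1),
        ((k : R) + 1) * (Nat.stirlingSecond n (k + 1) : R) * (descPochhammer R (k + 1)).eval x =
        ∑ k ∈ Finset.range (n + 1),
          (k : R) * (Nat.stirlingSecond n k : R) * (descPochhammer R k).eval x := by
      have h := Finset.sum_range_succ' (fun k : ℕ => (k : R) * (Nat.stirlingSecond n k : R) *
        (descPochhammer R k).eval x) (n + 1)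
      rw [Finset.sum_range_succ, Nat.stirlingSecond_eq_zero_of_lt n.lt_succ_self] at h
      simpa using h.symm
    rw [Finset.sum_range_succ', pow_succ, ih, Finset.sum_mul]
    simp only [Nat.stirlingSecond_succ_succ, Nat.stirlingSecond_succ_zero, Nat.cast_zero, zero_mul,
      add_zero, Nat.cast_add, Nat.cast_mul, add_mul, Finset.sum_add_distrib, Nat.cast_one]
      at shift ⊢
    rw [shift, ← Finset.sum_add_distrib]
    refine Finset.sum_congr rfl fun k _ => ?_
    rw [descPochhammer_succ_eval]
    ring

variable {𝕜 : Type*} [NormedField 𝕜]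

theorem hasSum_descFactorial_mul_geometric_of_norm_lt_one (k : ℕ) {z : 𝕜} (hz : ‖z‖ < 1) :
    HasSum (fun m : ℕ => (m.descFactorial k : 𝕜) * z ^ m)
      (k.factorial * z ^ k / (1 - z) ^ (k + 1)) := by
  have vanish : ∀ m ∉ range (· + k), (m.descFactorial k : 𝕜) * z ^ m = 0 := fun m hm => by
    have hmk : m < k := not_le.1 fun h => hm ⟨m - k, Nat.sub_add_cancel h⟩
    rw [Nat.descFactorial_eq_zero_iff_lt.2 hmk, Nat.cast_zero, zero_mul]
  rw [← (add_left_injective k).hasSum_iff vanish, mul_div_assoc, ← mul_one_div, ← mul_assoc]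
  convert! (hasSum_choose_mul_geometric_of_norm_lt_one k hz).mul_left (k.factorial * z ^ k) using 2
    with m
  simp only [Function.comp, Nat.descFactorial_eq_factorial_mul_choose, pow_add, Nat.cast_mul]
  ring

theorem hasSum_pow_mul_geometric_of_norm_lt_one (n : ℕ) {z : 𝕜} (hz : ‖z‖ < 1) :
    HasSum (fun m : ℕ => (m : 𝕜) ^ n * z ^ m)
      (∑ k ∈ Finset.range (n + 1),
        (Nat.stirlingSecond n k : 𝕜) * (k.factorial * z ^ k / (1 - z) ^ (k + 1))) := by
  convert! hasSum_sum fun k _ =>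
    (hasSum_descFactorial_mul_geometric_of_norm_lt_one k hz).mul_left
      (Nat.stirlingSecond n k : 𝕜) using 2 with m
  rw [pow_eq_sum_stirlingSecond_mul_descPochhammer, Finset.sum_mul]
  simp only [descPochhammer_eval_eq_descFactorial, mul_assoc]

theorem hasSum_pow_mul_inv_pow (n : ℕ) {y : ℝ} (hy : 1 < |y|) :
    HasSum (fun m : ℕ => (m : ℝ) ^ n * y⁻¹ ^ m) (y / (y - 1) * geomPoly n (1 / (y - 1))) := by
  have hy0 : y ≠ 0 := fun h => by simp [h, not_lt.2 zero_le_one] at hy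
  have hy1 : y - 1 ≠ 0 := fun h => by simp [sub_eq_zero.1 h] at hy
  have hz : 1 - y⁻¹ = (y - 1) / y := by field_simp
  convert! hasSum_pow_mul_geometric_of_norm_lt_one n (z := y⁻¹)
    (by rw [norm_inv]; exact inv_lt_one_of_one_lt₀ hy) using 1
  rw [geomPoly, Finset.mul_sum]
  refine Finset.sum_congr rfl fun k _ => ?_
  rw [hz, div_pow, div_pow, inv_pow]
  field_simp
  ring

end PowerSeries

section VerticalLines

open Complex

theorem norm_le_norm_add_natCast {s : ℂ} (hs : 0 ≤ s.re) (k : ℕ) : ‖s‖ ≤ ‖s + k‖ := by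
  rw [Complex.norm_def, Complex.norm_def]
  refine Real.sqrt_le_sqrt ?_
  simp only [normSq_apply, add_re, add_im, natCast_re, natCast_im, add_zero]
  nlinarith [k.cast_nonneg (α := ℝ)]

theorem add_natCast_ne_zero_of_re_pos {s : ℂ} (hs : 0 < s.re) (k : ℕ) : s + k ≠ 0 := fun h => by
  have hre : s.re + k = 0 := by simpa only [add_re, natCast_re, zero_re] using congrArg re h
  linarith [k.cast_nonneg (α := ℝ)]

theorem norm_Gamma_le_Gamma_re {s : ℂ} (hs : 0 < s.re) : ‖Gamma s‖ ≤ Real.Gamma s.re := by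
  rw [Gamma_eq_integral hs, Real.Gamma_eq_integral hs, GammaIntegral]
  refine (norm_integral_le_integral_norm _).trans_eq ?_
  refine setIntegral_congr_fun measurableSet_Ioi fun x hx => ?_
  simp only [norm_mul, norm_cpow_eq_rpow_re_of_pos hx, sub_re, one_re,
    Complex.norm_of_nonneg (Real.exp_pos _).le]

theorem norm_pow_mul_Gamma_le_norm_Gamma_add {s : ℂ} (hs : 0 < s.re) (m : ℕ) :
    ‖s ^ m * Gamma s‖ ≤ ‖Gamma (s + m)‖ := by
  induction m with
  | zero => simp
  | succ m ih =>
    rw [Nat.cast_succ, ← add_assoc, Gamma_add_one _ (add_natCast_ne_zero_of_re_pos hs m), pow_succ',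
      mul_assoc, norm_mul, norm_mul (s + m)]
    gcongr
    exact norm_le_norm_add_natCast hs.le m

theorem norm_pow_mul_Gamma_le_Gamma_re_add {s : ℂ} (hs : 0 < s.re) (m : ℕ) :
    ‖s ^ m * Gamma s‖ ≤ Real.Gamma (s.re + m) := by
  have hre : (s + m).re = s.re + m := by rw [add_re, natCast_re]
  rw [← hre]
  exact (norm_pow_mul_Gamma_le_norm_Gamma_add hs m).trans
    (norm_Gamma_le_Gamma_re (hre ▸ by positivity))

theorem continuousAt_Gamma_of_re_pos {s : ℂ} (hs : 0 < s.re) : ContinuousAt Gamma s :=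
  (differentiableAt_Gamma s fun m h =>
    add_natCast_ne_zero_of_re_pos hs m (by rw [h, neg_add_cancel])).continuousAt

theorem re_ofReal_add_ofReal_mul_I (a t : ℝ) : ((a : ℂ) + t * I).re = a := by simp

theorem continuous_comp_verticalLine {g : ℂ → ℂ} {a : ℝ}
    (hg : ∀ s : ℂ, s.re = a → ContinuousAt g s) : Continuous fun t : ℝ => g (a + t * I) :=
  continuous_iff_continuousAt.2 fun t =>
    (hg _ (re_ofReal_add_ofReal_mul_I a t)).comp (f := fun t : ℝ => (a : ℂ) + t * I) (by fun_prop)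

theorem verticalIntegrable_bdd_mul {f g : ℂ → ℂ} {a C : ℝ} (hf : VerticalIntegrable f a)
    (hg : ∀ s : ℂ, s.re = a → ContinuousAt g s) (hC : ∀ s : ℂ, s.re = a → ‖g s‖ ≤ C) :
    VerticalIntegrable (fun s => g s * f s) a :=
  Integrable.bdd_mul hf (continuous_comp_verticalLine hg).aestronglyMeasurable
    (Filter.Eventually.of_forall fun t => hC _ (re_ofReal_add_ofReal_mul_I a t))

theorem verticalIntegrable_pow_mul_Gamma (n : ℕ) {a : ℝ} (ha : 0 < a) :
    VerticalIntegrable (fun s => s ^ n * Gamma s) a := by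
  have hcont : Continuous fun t : ℝ => (a + t * I) ^ n * Gamma (a + t * I) :=
    continuous_comp_verticalLine (g := fun s => s ^ n * Gamma s) fun s hs =>
      (continuousAt_id.pow n).mul (continuousAt_Gamma_of_re_pos (hs ▸ ha))
  refine (integrable_inv_one_add_sq.const_mul
    (Real.Gamma (a + n) + Real.Gamma (a + (n + 2 : ℕ)))).mono' hcont.aestronglyMeasurable
    (Filter.Eventually.of_forall fun t => ?_)
  have hre := re_ofReal_add_ofReal_mul_I a t
  have hn := norm_pow_mul_Gamma_le_Gamma_re_add (hre.symm ▸ ha) n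
  have hn2 := norm_pow_mul_Gamma_le_Gamma_re_add (hre.symm ▸ ha) (n + 2)
  rw [hre] at hn hn2
  have ht : t ^ 2 ≤ ‖(a : ℂ) + t * I‖ ^ 2 := by
    rw [← normSq_eq_norm_sq, normSq_add_mul_I]
    exact le_add_of_nonneg_left (sq_nonneg a)
  rw [← div_eq_mul_inv, le_div_iff₀ (by positivity), mul_add, mul_one]
  refine add_le_add hn (le_trans ?_ hn2)
  rw [pow_add, mul_right_comm, norm_mul _ (_ ^ 2), norm_pow _ 2]
  gcongr

theorem verticalIntegrable_Gamma {a : ℝ} (ha : 0 < a) : VerticalIntegrable Gamma a := by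
  simpa only [pow_zero, one_mul] using verticalIntegrable_pow_mul_Gamma 0 ha

theorem verticalIntegrable_cpow_neg_mul {f : ℂ → ℂ} {a x : ℝ} (hf : VerticalIntegrable f a)
    (hx : 0 < x) : VerticalIntegrable (fun s => (x : ℂ) ^ (-s) * f s) a :=
  verticalIntegrable_bdd_mul hf
    (fun _ _ => continuousAt_neg.const_cpow (Or.inl (ofReal_ne_zero.2 hx.ne')))
    (fun s hs => by rw [norm_cpow_eq_rpow_re_of_pos hx, neg_re, hs])

theorem verticalIntegrable_Gamma_sub_mul {f : ℂ → ℂ} {a : ℝ} {ρ : ℂ}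
    (hf : VerticalIntegrable f a) (ha : a < ρ.re) :
    VerticalIntegrable (fun s => Gamma (ρ - s) * f s) a := by
  have hre : ∀ s : ℂ, s.re = a → (ρ - s).re = ρ.re - a := fun s hs => by rw [sub_re, hs]
  refine verticalIntegrable_bdd_mul (C := Real.Gamma (ρ.re - a)) hf (fun s hs => ?_) fun s hs => ?_
  · exact (continuousAt_Gamma_of_re_pos (hre s hs ▸ sub_pos.2 ha)).comp
      (f := fun s => ρ - s) (by fun_prop)
  · exact hre s hs ▸ norm_Gamma_le_Gamma_re (hre s hs ▸ sub_pos.2 ha)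

theorem summable_one_div_natCast_add_one_rpow {σ : ℝ} (hσ : 1 < σ) :
    Summable fun m : ℕ => 1 / ((m : ℝ) + 1) ^ σ := by
  exact_mod_cast (summable_nat_add_iff 1).2 (Real.summable_one_div_nat_rpow.2 hσ)

theorem norm_natCast_add_one_cpow (m : ℕ) (s : ℂ) :
    ‖((m : ℂ) + 1) ^ s‖ = ((m : ℝ) + 1) ^ s.re := by
  exact_mod_cast norm_cpow_eq_rpow_re_of_pos m.cast_add_one_pos s

theorem norm_riemannZeta_le_tsum {s : ℂ} (hs : 1 < s.re) :
    ‖riemannZeta s‖ ≤ ∑' m : ℕ, 1 / ((m : ℝ) + 1) ^ s.re := by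
  rw [zeta_eq_tsum_one_div_nat_add_one_cpow hs]
  refine tsum_of_norm_bounded (summable_one_div_natCast_add_one_rpow hs).hasSum fun m => ?_
  rw [norm_div, norm_one, norm_natCast_add_one_cpow]

theorem verticalIntegrable_riemannZeta_sub_mul {f : ℂ → ℂ} {a : ℝ} {c : ℂ}
    (hf : VerticalIntegrable f a) (ha : c.re + 1 < a) :
    VerticalIntegrable (fun s => riemannZeta (s - c) * f s) a := by
  have hre : ∀ s : ℂ, s.re = a → (s - c).re = a - c.re := fun s hs => by rw [sub_re, hs]
  have hac : 1 < a - c.re := by linarith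
  refine verticalIntegrable_bdd_mul (C := ∑' m : ℕ, 1 / ((m : ℝ) + 1) ^ (a - c.re)) hf
    (fun s hs => ?_) fun s hs => ?_
  · have hne : s - c ≠ 1 := fun h => hac.ne' (by rw [← hre s hs, h, one_re])
    exact (differentiableAt_riemannZeta hne).continuousAt.comp (f := fun s => s - c) (by fun_prop)
  · exact hre s hs ▸ norm_riemannZeta_le_tsum (hre s hs ▸ hac)

theorem eq_vertLineIntegral_of_hasMellin {f : ℝ → ℂ} {F : ℂ → ℂ} {a x : ℝ} (hx : 0 < x)
    (hM : ∀ s : ℂ, s.re = a → HasMellin f s (F s)) (hF : VerticalIntegrable F a)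
    (hf : ContinuousAt f x) :
    f x = 1 / (2 * (Real.pi : ℂ) * I) *
      vertLineIntegral a (fun s => (x : ℂ) ^ (-s) * F s) := by
  have hline : ∀ t : ℝ, mellin f (a + t * I) = F (a + t * I) := fun t =>
    (hM _ (re_ofReal_add_ofReal_mul_I a t)).2
  have hinv := mellinInv_mellin_eq a f hx (hM a (ofReal_re a)).1
    (hF.congr (Filter.Eventually.of_forall fun t => (hline t).symm)) hf
  have hpi : (Real.pi : ℂ) ≠ 0 := ofReal_ne_zero.2 Real.pi_ne_zero
  rw [← hinv, mellinInv, vertLineIntegral, ← mul_assoc, real_smul]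
  simp only [hline, smul_eq_mul]
  congr 1
  push_cast
  field_simp

end VerticalLines

section BetaIntegral

open Complex

variable {E : Type*} [NormedAddCommGroup E] [NormedSpace ℝ E]

theorem image_div_one_sub_Ioo : (fun u : ℝ => u / (1 - u)) '' Ioo 0 1 = Ioi 0 := by
  ext x
  constructor
  · rintro ⟨u, ⟨h0, h1⟩, rfl⟩
    exact div_pos h0 (sub_pos.2 h1)
  · intro (hx : 0 < x)
    refine ⟨x / (1 + x), ⟨by positivity, (div_lt_one (by positivity)).2 (by linarith)⟩, ?_⟩
    field_simp
    ring

theorem injOn_div_one_sub_Ioo : InjOn (fun u : ℝ => u / (1 - u)) (Ioo 0 1) := by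
  intro u hu v hv (h : u / (1 - u) = v / (1 - v))
  rw [div_eq_div_iff (sub_pos.2 hu.2).ne' (sub_pos.2 hv.2).ne'] at h
  linarith

theorem hasDerivAt_div_one_sub {u : ℝ} (hu : u ≠ 1) :
    HasDerivAt (fun u : ℝ => u / (1 - u)) (1 / (1 - u) ^ 2) u := by
  refine ((hasDerivAt_id' u).div ((hasDerivAt_id' u).const_sub 1)
    (sub_ne_zero.2 hu.symm)).congr_deriv ?_
  ring

theorem integrableOn_Ioi_iff_integrableOn_Ioo_div_one_sub (f : ℝ → E) :
    IntegrableOn f (Ioi 0) ↔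
      IntegrableOn (fun u : ℝ => (1 / (1 - u) ^ 2) • f (u / (1 - u))) (Ioo 0 1) := by
  rw [← image_div_one_sub_Ioo, integrableOn_image_iff_integrableOn_abs_deriv_smul measurableSet_Ioo
    (fun u hu => (hasDerivAt_div_one_sub hu.2.ne).hasDerivWithinAt) injOn_div_one_sub_Ioo]
  simp only [abs_div, abs_one, abs_pow, sq_abs]

theorem integral_Ioi_eq_integral_Ioo_div_one_sub (f : ℝ → E) :
    ∫ x in Ioi (0 : ℝ), f x = ∫ u in Ioo (0 : ℝ) 1, (1 / (1 - u) ^ 2) • f (u / (1 - u)) := by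
  rw [← image_div_one_sub_Ioo, integral_image_eq_integral_abs_deriv_smul measurableSet_Ioo
    (fun u hu => (hasDerivAt_div_one_sub hu.2.ne).hasDerivWithinAt) injOn_div_one_sub_Ioo]
  simp only [abs_div, abs_one, abs_pow, sq_abs]

theorem betaIntegrand_div_one_sub (s ρ : ℂ) {u : ℝ} (hu : u ∈ Ioo (0 : ℝ) 1) :
    (1 / (1 - u) ^ 2) • (((u / (1 - u) : ℝ) : ℂ) ^ (s - 1) •
      (1 + ((u / (1 - u) : ℝ) : ℂ)) ^ (-ρ)) =
      (u : ℂ) ^ (s - 1) * (1 - (u : ℂ)) ^ (ρ - s - 1) := by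
  have hv : 0 < 1 - u := sub_pos.2 hu.2
  have hv0 : ((1 - u : ℝ) : ℂ) ≠ 0 := ofReal_ne_zero.2 hv.ne'
  have hsub : 1 - (u : ℂ) = ((1 - u : ℝ) : ℂ) := by rw [ofReal_sub, ofReal_one]
  have hone_add : 1 + ((u / (1 - u) : ℝ) : ℂ) = ((1 - u : ℝ) : ℂ)⁻¹ := by
    rw [← ofReal_inv, ← ofReal_one, ← ofReal_add]
    congr 1
    field_simp
    ring
  have hinv : ∀ w : ℂ, ((1 - u : ℝ) : ℂ)⁻¹ ^ w = ((1 - u : ℝ) : ℂ) ^ (-w) := fun w => by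
    rw [inv_cpow _ _ (by rw [arg_ofReal_of_nonneg hv.le]; exact Real.pi_pos.ne), cpow_neg]
  have hexp : ρ - s - 1 = -(s - 1) + ρ - (2 : ℕ) := by push_cast; ring
  rw [hone_add, div_eq_mul_inv u, ofReal_mul, mul_cpow_ofReal_nonneg hu.1.le (inv_pos.2 hv).le,
    ofReal_inv, hinv, hinv, neg_neg, hsub, hexp, cpow_sub _ _ hv0,
    cpow_add _ _ hv0, cpow_natCast, real_smul, smul_eq_mul]
  push_cast
  ring

theorem hasMellin_one_add_cpow_neg {s ρ : ℂ} (hs : 0 < s.re) (hρ : s.re < ρ.re) :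
    HasMellin (fun x : ℝ => (1 + (x : ℂ)) ^ (-ρ)) s (Gamma s * Gamma (ρ - s) / Gamma ρ) := by
  have hv : 0 < (ρ - s).re := by rwa [sub_re, sub_pos]
  constructor
  · rw [MellinConvergent, integrableOn_Ioi_iff_integrableOn_Ioo_div_one_sub,
      integrableOn_congr_fun (fun u hu => betaIntegrand_div_one_sub s ρ hu) measurableSet_Ioo,
      ← integrableOn_Ioc_iff_integrableOn_Ioo,
      ← intervalIntegrable_iff_integrableOn_Ioc_of_le zero_le_one]
    exact betaIntegral_convergent hs hv
  · have hB := betaIntegral_eq_Gamma_mul_div s (ρ - s) hs hv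
    rw [add_sub_cancel] at hB
    rw [← hB, mellin, integral_Ioi_eq_integral_Ioo_div_one_sub,
      setIntegral_congr_fun measurableSet_Ioo fun u hu => betaIntegrand_div_one_sub s ρ hu,
      betaIntegral, intervalIntegral.integral_of_le zero_le_one, integral_Ioc_eq_integral_Ioo]

theorem hasMellin_cpow_mul_one_add_cpow_neg {s c ρ : ℂ} (hs : 0 < (s + c).re)
    (hρ : (s + c).re < ρ.re) :
    HasMellin (fun x : ℝ => (x : ℂ) ^ c • (1 + (x : ℂ)) ^ (-ρ)) s
      (Gamma (s + c) * Gamma (ρ - (s + c)) / Gamma ρ) := by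
  have h := hasMellin_one_add_cpow_neg hs hρ
  exact ⟨MellinConvergent.cpow_smul.2 h.1, (mellin_cpow_smul _ _ _).trans h.2⟩

end BetaIntegral

section GenGeomPoly

open Complex

theorem hasMellin_finset_sum {ι E : Type*} [NormedAddCommGroup E] [NormedSpace ℂ E]
    {t : Finset ι} {f : ι → ℝ → E} {m : ι → E} {s : ℂ} (h : ∀ i ∈ t, HasMellin (f i) s (m i)) :
    HasMellin (fun x => ∑ i ∈ t, f i x) s (∑ i ∈ t, m i) := by
  constructor
  · simp only [MellinConvergent, Finset.smul_sum]
    exact integrable_finsetSum t fun i hi => (h i hi).1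
  · simp only [mellin, Finset.smul_sum]
    rw [integral_finsetSum t fun i hi => (h i hi).1]
    exact Finset.sum_congr rfl fun i hi => (h i hi).2

theorem hasMellin_congr {E : Type*} [NormedAddCommGroup E] [NormedSpace ℂ E]
    {f g : ℝ → E} {m : E} {s : ℂ} (h : HasMellin f s m) (hfg : EqOn f g (Ioi 0)) :
    HasMellin g s m := by
  have hsmul : EqOn (fun x : ℝ => (x : ℂ) ^ (s - 1) • f x) (fun x => (x : ℂ) ^ (s - 1) • g x)
      (Ioi 0) := fun x hx => congrArg _ (hfg hx)
  exact ⟨h.1.congr_fun hsmul measurableSet_Ioi,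
    (setIntegral_congr_fun measurableSet_Ioi hsmul).symm.trans h.2⟩

theorem sum_stirlingSecond_mul_Gamma_add (n : ℕ) {s : ℂ} (hs : ∀ m : ℕ, s ≠ -m) :
    ∑ k ∈ Finset.range (n + 1), (Nat.stirlingSecond n k : ℂ) * (-1) ^ k * Gamma (s + k) =
      (-s) ^ n * Gamma s := by
  rw [pow_eq_sum_stirlingSecond_mul_descPochhammer, Finset.sum_mul]
  refine Finset.sum_congr rfl fun k _ => ?_
  rw [← div_mul_cancel₀ (Gamma (s + k)) (Gamma_ne_zero hs), Gamma_add_nat_div_Gamma_eq s hs,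
    ← neg_neg s, ascPochhammer_eval_neg_eq_descPochhammer, neg_neg]
  linear_combination (Nat.stirlingSecond n k : ℂ) * (descPochhammer ℂ k).eval (-s) * Gamma s *
    pow_mul_pow_eq_one k (neg_one_mul (-1 : ℂ) |>.trans (neg_neg 1))

theorem one_add_rpow_mul_genGeomPoly_eq_sum (n : ℕ) (r : ℝ) {x : ℝ} (hx : 0 < x) :
    ((1 / (1 + x) ^ r * genGeomPoly n r (-x / (1 + x)) : ℝ) : ℂ) =
      ∑ k ∈ Finset.range (n + 1),
        ((Nat.stirlingSecond n k : ℂ) * (-1) ^ k * (Gamma (r + k) / Gamma r)) •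
          ((x : ℂ) ^ (k : ℂ) • (1 + (x : ℂ)) ^ (-((r : ℂ) + k))) := by
  have hx1 : 0 < 1 + x := by linarith
  have hx0 : (1 + (x : ℂ)) ≠ 0 := by exact_mod_cast hx1.ne'
  have hpow : (((1 + x) ^ r : ℝ) : ℂ) = (1 + (x : ℂ)) ^ (r : ℂ) := by
    rw [ofReal_cpow hx1.le, ofReal_add, ofReal_one]
  have hΓ : ∀ k : ℕ, ((Real.Gamma (k + r) : ℝ) : ℂ) = Gamma (r + k) := fun k => by
    rw [← Gamma_ofReal, ofReal_add, ofReal_natCast, add_comm]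
  rw [genGeomPoly, mul_left_comm, Finset.mul_sum, Finset.mul_sum, ofReal_sum]
  refine Finset.sum_congr rfl fun k _ => ?_
  rw [ofReal_mul, ofReal_mul, ofReal_mul, ofReal_mul, ofReal_div, ofReal_div, hpow, hΓ,
    ← Gamma_ofReal, cpow_neg, cpow_add _ _ hx0, cpow_natCast, cpow_natCast]
  push_cast
  rw [div_pow, neg_pow, smul_eq_mul, smul_eq_mul]
  field_simp

theorem hasMellin_one_add_rpow_mul_genGeomPoly (n : ℕ) {r : ℝ} {s : ℂ} (hs : 0 < s.re)
    (hr : s.re < r) :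
    HasMellin (fun x : ℝ => ((1 / (1 + x) ^ r * genGeomPoly n r (-x / (1 + x)) : ℝ) : ℂ)) s
      ((-1) ^ n / Gamma r * (s ^ n * Gamma s * Gamma (r - s))) := by
  have hterm : ∀ k : ℕ, HasMellin
      (fun x : ℝ => (x : ℂ) ^ (k : ℂ) • (1 + (x : ℂ)) ^ (-((r : ℂ) + k))) s
      (Gamma (s + k) * Gamma (r - s) / Gamma (r + k)) := fun k => by
    have h := hasMellin_cpow_mul_one_add_cpow_neg (s := s) (c := k) (ρ := r + k)
      (by rw [add_re, natCast_re]; positivity) (by simpa using hr)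
    rwa [add_sub_add_right_eq_sub] at h
  have hsum := hasMellin_finset_sum (t := Finset.range (n + 1)) fun k _ =>
    hasMellin_const_smul (hterm k).1
      ((Nat.stirlingSecond n k : ℂ) * (-1) ^ k * (Gamma (r + k) / Gamma r))
  refine hasMellin_congr ?_ fun x hx => (one_add_rpow_mul_genGeomPoly_eq_sum n r hx).symm
  convert! hsum using 1
  have hne : ∀ m : ℕ, s ≠ -m := fun m h =>
    add_natCast_ne_zero_of_re_pos hs m (by rw [h, neg_add_cancel])
  calc (-1) ^ n / Gamma r * (s ^ n * Gamma s * Gamma (r - s))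
      = (-s) ^ n * Gamma s * (Gamma (r - s) / Gamma r) := by rw [neg_pow]; ring
    _ = _ := by
      rw [← sum_stirlingSecond_mul_Gamma_add n hne, Finset.sum_mul]
      refine Finset.sum_congr rfl fun k _ => ?_
      have hΓ : Gamma ((r : ℂ) + k) ≠ 0 := Gamma_ne_zero_of_re_pos
        (by rw [add_re, ofReal_re, natCast_re]; linarith [k.cast_nonneg (α := ℝ)])
      rw [(hterm k).2, smul_eq_mul]
      field_simp

theorem verticalIntegrable_cpow_neg_mul_pow_mul_Gamma_mul_Gamma_sub (n : ℕ) {r x a : ℝ}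
    (hx : 0 < x) (ha : 0 < a) (har : a < r) :
    VerticalIntegrable (fun s => (x : ℂ) ^ (-s) * s ^ n * Gamma s * Gamma (r - s)) a := by
  have h := verticalIntegrable_cpow_neg_mul (verticalIntegrable_Gamma_sub_mul (ρ := r)
    (verticalIntegrable_pow_mul_Gamma n ha) (by rwa [ofReal_re])) hx
  refine h.congr (Filter.Eventually.of_forall fun t => ?_)
  ring

theorem vertLineIntegral_const_mul (a : ℝ) (c : ℂ) (F : ℂ → ℂ) :
    vertLineIntegral a (fun s => c * F s) = c * vertLineIntegral a F := by
  rw [vertLineIntegral, vertLineIntegral, integral_const_mul, mul_left_comm]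

theorem continuous_genGeomPoly (n : ℕ) (r : ℝ) : Continuous (genGeomPoly n r) := by
  unfold genGeomPoly
  fun_prop

theorem genGeomPoly_eq_vertLineIntegral (n : ℕ) {r x a : ℝ} (hx : 0 < x) (ha : 0 < a)
    (har : a < r) :
    ((1 / (1 + x) ^ r * genGeomPoly n r (-x / (1 + x)) : ℝ) : ℂ) =
      (-1) ^ n / (2 * (Real.pi : ℂ) * I * Gamma r) *
        vertLineIntegral a (fun s => (x : ℂ) ^ (-s) * s ^ n * Gamma s * Gamma (r - s)) := by
  have hx1 : 1 + x ≠ 0 := by positivity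
  have hint : VerticalIntegrable
      (fun s => (-1) ^ n / Gamma r * (s ^ n * Gamma s * Gamma (r - s))) a := by
    refine ((verticalIntegrable_Gamma_sub_mul (ρ := r) (verticalIntegrable_pow_mul_Gamma n ha)
      (by rwa [ofReal_re])).const_mul ((-1) ^ n / Gamma r)).congr
      (Filter.Eventually.of_forall fun t => ?_)
    ring
  have hcont : ContinuousAt
      (fun x => ((1 / (1 + x) ^ r * genGeomPoly n r (-x / (1 + x)) : ℝ) : ℂ)) x := by
    have hpow : ContinuousAt (fun x : ℝ => (1 + x) ^ r) x :=
      ContinuousAt.rpow_const (by fun_prop) (Or.inl hx1)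
    have hpoly : ContinuousAt (fun x : ℝ => genGeomPoly n r (-x / (1 + x))) x :=
      (continuous_genGeomPoly n r).continuousAt.comp (f := fun x : ℝ => -x / (1 + x))
        (by fun_prop (disch := exact hx1))
    have hne : (1 + x) ^ r ≠ 0 := by positivity
    exact continuous_ofReal.continuousAt.comp ((continuousAt_const.div hpow hne).mul hpoly)
  have hinv := eq_vertLineIntegral_of_hasMellin hx
    (fun s hs => hasMellin_one_add_rpow_mul_genGeomPoly n (hs ▸ ha) (hs ▸ har)) hint hcont
  rw [hinv]
  simp only [mul_left_comm _ ((-1) ^ n / Gamma (r : ℂ)), vertLineIntegral_const_mul]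
  simp only [← mul_assoc]
  congr 1
  ring

end GenGeomPoly

section RiemannZeta

open Complex

theorem one_lt_abs_exp {x : ℝ} (hx : 0 < x) : 1 < |Real.exp x| := by
  rw [Real.abs_exp]
  exact Real.one_lt_exp_iff.2 hx

theorem hasSum_add_one_pow_mul_exp_neg (n : ℕ) {x : ℝ} (hx : 0 < x) :
    HasSum (fun m : ℕ => ((m : ℂ) + 1) ^ n * Real.exp (-(m + 1) * x))
      (((Real.exp x / (Real.exp x - 1) * geomPoly n (1 / (Real.exp x - 1)) : ℝ) : ℂ) -
        if n = 0 then 1 else 0) := by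
  have h := hasSum_ofReal.2
    ((hasSum_nat_add_iff' 1).2 (hasSum_pow_mul_inv_pow n (one_lt_abs_exp hx)))
  convert! h using 1
  · ext m
    rw [← Real.exp_neg, ← Real.exp_nat_mul, ofReal_mul, ofReal_pow, ofReal_natCast,
      Nat.cast_add_one, neg_mul_comm, Nat.cast_add_one]
  · rw [Finset.sum_range_one, pow_zero, mul_one, Nat.cast_zero, zero_pow_eq, ofReal_sub]
    split_ifs <;> norm_num

theorem hasMellin_of_hasSum_cpow_mul_exp_neg {c s : ℂ} (hs : 0 < s.re) (hcs : c.re + 1 < s.re)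
    {F : ℝ → ℂ}
    (hF : ∀ x ∈ Ioi 0,
      HasSum (fun m : ℕ => ((m : ℂ) + 1) ^ c * Real.exp (-((m : ℝ) + 1) * x)) (F x)) :
    HasMellin F s (riemannZeta (s - c) * Gamma s) := by
  have hsc : 1 < s.re - c.re := by linarith
  have hsummable : Summable fun m : ℕ => ‖((m : ℂ) + 1) ^ c‖ / ((m : ℝ) + 1) ^ s.re := by
    refine (summable_one_div_natCast_add_one_rpow hsc).congr fun m => ?_
    rw [norm_natCast_add_one_cpow, Real.rpow_sub m.cast_add_one_pos, one_div_div]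
  have hsum := hasSum_mellin (fun m => Or.inr m.cast_add_one_pos) hs hF hsummable
  have hmellin : mellin F s = riemannZeta (s - c) * Gamma s := by
    rw [← hsum.tsum_eq, zeta_eq_tsum_one_div_nat_add_one_cpow hsc, ← tsum_mul_right]
    refine tsum_congr fun m => ?_
    rw [cpow_sub _ _ m.cast_add_one_ne_zero, one_div_div]
    push_cast
    ring
  -- The integral converges because its value is not zero.
  exact ⟨.of_integral_ne_zero <| hmellin.trans_ne <|
    mul_ne_zero (riemannZeta_ne_zero_of_one_lt_re hsc) (Gamma_ne_zero_of_re_pos hs), hmellin⟩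

theorem hasMellin_exp_div_mul_geomPoly_sub (n : ℕ) {s : ℂ} (hs : (n : ℝ) + 1 < s.re) :
    HasMellin (fun x : ℝ =>
        ((Real.exp x / (Real.exp x - 1) * geomPoly n (1 / (Real.exp x - 1)) : ℝ) : ℂ) -
          if n = 0 then 1 else 0) s
      (riemannZeta (s - n) * Gamma s) := by
  refine hasMellin_of_hasSum_cpow_mul_exp_neg (by linarith [n.cast_nonneg (α := ℝ)])
    (by rwa [natCast_re]) fun x hx => ?_
  simpa only [cpow_natCast] using hasSum_add_one_pow_mul_exp_neg n hx

theorem continuous_geomPoly (n : ℕ) : Continuous (geomPoly n) := by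
  unfold geomPoly
  fun_prop

theorem verticalIntegrable_cpow_neg_mul_riemannZeta_sub_mul_Gamma (n : ℕ) {x a : ℝ} (hx : 0 < x)
    (ha : (n : ℝ) + 1 < a) :
    VerticalIntegrable (fun s => (x : ℂ) ^ (-s) * riemannZeta (s - n) * Gamma s) a := by
  have ha0 : 0 < a := by linarith [n.cast_nonneg (α := ℝ)]
  simpa only [mul_assoc] using verticalIntegrable_cpow_neg_mul
    (verticalIntegrable_riemannZeta_sub_mul (verticalIntegrable_Gamma ha0)
      (by rwa [natCast_re])) hx

theorem geomPoly_eq_vertLineIntegral_riemannZeta (n : ℕ) {x a : ℝ} (hx : 0 < x)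
    (ha : (n : ℝ) + 1 < a) :
    ((Real.exp x / (Real.exp x - 1) * geomPoly n (1 / (Real.exp x - 1)) : ℝ) : ℂ) =
      (if n = 0 then 1 else 0) + 1 / (2 * (Real.pi : ℂ) * I) *
        vertLineIntegral a (fun s => (x : ℂ) ^ (-s) * riemannZeta (s - n) * Gamma s) := by
  have ha0 : 0 < a := by linarith [n.cast_nonneg (α := ℝ)]
  have hne : Real.exp x - 1 ≠ 0 := (sub_pos.2 (Real.one_lt_exp_iff.2 hx)).ne'
  have hcont : ContinuousAt (fun x : ℝ =>
      ((Real.exp x / (Real.exp x - 1) * geomPoly n (1 / (Real.exp x - 1)) : ℝ) : ℂ) -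
        if n = 0 then 1 else 0) x := by
    have hpoly : ContinuousAt (fun x : ℝ => geomPoly n (1 / (Real.exp x - 1))) x :=
      (continuous_geomPoly n).continuousAt.comp (f := fun x : ℝ => 1 / (Real.exp x - 1))
        (by fun_prop (disch := exact hne))
    fun_prop (disch := exact hne)
  have hinv := eq_vertLineIntegral_of_hasMellin hx
    (fun s hs => hasMellin_exp_div_mul_geomPoly_sub n (hs ▸ ha))
    (verticalIntegrable_riemannZeta_sub_mul (verticalIntegrable_Gamma ha0)
      (by rwa [natCast_re])) hcont
  simp only [← mul_assoc] at hinv ⊢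
  rw [← hinv, add_sub_cancel]

end RiemannZeta

section LaplaceTransform

open Complex

theorem norm_exp_neg_mul_ofReal (w : ℂ) (t : ℝ) : ‖exp (-(w * t))‖ = Real.exp (-(w.re * t)) := by
  rw [norm_exp, neg_re, re_mul_ofReal]

theorem norm_pow_mul_exp_neg_mul (n : ℕ) (w : ℂ) {t : ℝ} (ht : 0 ≤ t) :
    ‖(t : ℂ) ^ n * exp (-(w * t))‖ = t ^ (n : ℝ) * Real.exp (-w.re * t) := by
  rw [norm_mul, norm_pow, norm_real, Real.norm_of_nonneg ht, norm_exp_neg_mul_ofReal,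
    Real.rpow_natCast, neg_mul]

theorem integrableOn_pow_mul_exp_neg_mul_Ioi (n : ℕ) {w : ℂ} (hw : 0 < w.re) :
    IntegrableOn (fun t : ℝ => (t : ℂ) ^ n * exp (-(w * t))) (Ioi 0) := by
  have hbound := integrableOn_rpow_mul_exp_neg_mul_rpow (p := 1) (s := n) (b := w.re)
    (by linarith [n.cast_nonneg (α := ℝ)]) one_pos hw
  refine Integrable.mono' hbound (by fun_prop) ?_
  filter_upwards [ae_restrict_mem measurableSet_Ioi] with t ht
  rw [norm_pow_mul_exp_neg_mul n w (mem_Ioi.1 ht).le, Real.rpow_one]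

theorem tendsto_pow_mul_exp_neg_mul_atTop_nhds_zero (n : ℕ) {w : ℂ} (hw : 0 < w.re) :
    Filter.Tendsto (fun t : ℝ => (t : ℂ) ^ n * exp (-(w * t))) Filter.atTop (nhds 0) := by
  refine tendsto_zero_iff_norm_tendsto_zero.2 <|
    (tendsto_rpow_mul_exp_neg_mul_atTop_nhds_zero n w.re hw).congr' ?_
  filter_upwards [Filter.eventually_ge_atTop 0] with t ht
  exact (norm_pow_mul_exp_neg_mul n w ht).symm

theorem hasDerivAt_pow_succ_mul_exp_neg_mul (n : ℕ) (w : ℂ) (t : ℝ) :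
    HasDerivAt (fun t : ℝ => (t : ℂ) ^ (n + 1) * exp (-(w * t)))
      ((n + 1) * ((t : ℂ) ^ n * exp (-(w * t))) - w * ((t : ℂ) ^ (n + 1) * exp (-(w * t)))) t := by
  have hexp : HasDerivAt (fun z : ℂ => exp (-(w * z))) (exp (-(w * t)) * -(w * 1)) t :=
    ((hasDerivAt_id (t : ℂ)).const_mul w).neg.cexp
  refine ((hasDerivAt_pow (n + 1) (t : ℂ)).mul hexp).comp_ofReal.congr_deriv ?_
  push_cast
  ring

theorem integral_pow_mul_exp_neg_mul_Ioi (n : ℕ) {w : ℂ} (hw : 0 < w.re) :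
    ∫ t in Ioi (0 : ℝ), (t : ℂ) ^ n * exp (-(w * t)) = n.factorial / w ^ (n + 1) := by
  induction n with
  | zero => simpa using integral_exp_mul_complex_Ioi (a := -w) (by simpa using hw) 0
  | succ n ih =>
    have hw0 : w ≠ 0 := fun h => hw.ne' (by rw [h, zero_re])
    have hint := (integrableOn_pow_mul_exp_neg_mul_Ioi n hw).const_mul ((n : ℂ) + 1)
    have hint_succ := (integrableOn_pow_mul_exp_neg_mul_Ioi (n + 1) hw).const_mul w
    have hparts := integral_Ioi_of_hasDerivAt_of_tendsto' (a := 0)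
      (fun t _ => hasDerivAt_pow_succ_mul_exp_neg_mul n w t) (hint.sub hint_succ)
      (tendsto_pow_mul_exp_neg_mul_atTop_nhds_zero (n + 1) hw)
    rw [integral_sub hint hint_succ, integral_const_mul, integral_const_mul, ih, ofReal_zero,
      zero_pow n.succ_ne_zero, zero_mul, sub_zero, sub_eq_zero, mul_comm w,
      ← div_eq_iff hw0] at hparts
    rw [← hparts, Nat.factorial_succ, Nat.cast_mul, Nat.cast_add_one, pow_succ _ (n + 1),
      mul_div_assoc', div_div]

theorem integral_norm_pow_mul_exp_neg_mul_Ioi (n : ℕ) {w : ℂ} (hw : 0 < w.re) :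
    ∫ t in Ioi (0 : ℝ), ‖(t : ℂ) ^ n * exp (-(w * t))‖ = n.factorial / w.re ^ (n + 1) := by
  apply ofReal_injective
  rw [← integral_complex_ofReal, ofReal_div, ofReal_pow, ofReal_natCast,
    ← integral_pow_mul_exp_neg_mul_Ioi n (w := w.re) (by rwa [ofReal_re])]
  refine setIntegral_congr_fun measurableSet_Ioi fun t (ht : 0 < t) => ?_
  simp only [norm_mul, norm_pow, norm_real, Real.norm_of_nonneg ht.le, norm_exp_neg_mul_ofReal]
  push_cast
  rfl

theorem hasSum_exp_neg_add_mul_natCast (w : ℂ) {p t : ℝ} (hp : 0 < p) (ht : 0 < t) :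
    HasSum (fun k : ℕ => exp (-((w + p * k) * t))) (exp (-(w * t)) / (1 - exp (-(p * t)))) := by
  have hnorm : ‖exp (-(p * t))‖ < 1 := by
    rw [norm_exp_neg_mul_ofReal, ofReal_re, Real.exp_lt_one_iff, neg_lt_zero]
    exact mul_pos hp ht
  have h := (hasSum_geometric_of_norm_lt_one hnorm).mul_left (exp (-(w * t)))
  refine h.congr_fun fun k => ?_
  rw [← exp_nat_mul, ← exp_add]
  ring_nf

theorem summable_one_div_add_mul_natCast_pow {n : ℕ} (hn : 1 ≤ n) {c p : ℝ} (hc : 0 < c)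
    (hp : 0 < p) : Summable fun k : ℕ => 1 / (c + p * k) ^ (n + 1) := by
  have h := ((Real.summable_one_div_nat_add_rpow (c / p) ((n + 1 : ℕ) : ℝ)).2
    (by exact_mod_cast Nat.lt_add_one_of_le hn)).mul_left (1 / p ^ (n + 1))
  refine h.congr fun k => ?_
  rw [Real.rpow_natCast, abs_of_pos (by positivity), one_div_mul_one_div, ← mul_pow]
  congr 2
  field_simp
  ring

theorem hasSum_factorial_div_add_mul_natCast_pow {n : ℕ} (hn : 1 ≤ n) {w : ℂ} (hw : 0 < w.re)
    {p : ℝ} (hp : 0 < p) :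
    HasSum (fun k : ℕ => (n.factorial : ℂ) / (w + p * k) ^ (n + 1))
      (∫ t in Ioi (0 : ℝ), (t : ℂ) ^ n * (exp (-(w * t)) / (1 - exp (-(p * t))))) := by
  have hre (k : ℕ) : (w + p * k).re = w.re + p * k := by
    rw [add_re, re_ofReal_mul, natCast_re]
  have hpos (k : ℕ) : 0 < (w + p * k).re := by
    rw [hre]
    positivity
  have hsum := hasSum_integral_of_summable_integral_norm
    (fun k => integrableOn_pow_mul_exp_neg_mul_Ioi n (hpos k)) (by
      simpa only [integral_norm_pow_mul_exp_neg_mul_Ioi n (hpos _), hre, mul_one_div] using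
        (summable_one_div_add_mul_natCast_pow hn hw hp).mul_left (n.factorial : ℝ))
  simp only [integral_pow_mul_exp_neg_mul_Ioi n (hpos _)] at hsum
  convert! hsum using 1
  exact setIntegral_congr_fun measurableSet_Ioi fun t ht =>
    ((hasSum_exp_neg_add_mul_natCast w hp ht).mul_left _).tsum_eq.symm

theorem integrableOn_pow_mul_exp_neg_div_one_sub_exp_neg {n : ℕ} (hn : 1 ≤ n) {w : ℂ}
    (hw : 0 < w.re) {p : ℝ} (hp : 0 < p) :
    IntegrableOn (fun t : ℝ => (t : ℂ) ^ n * (exp (-(w * t)) / (1 - exp (-(p * t)))))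
      (Ioi 0) := by
  -- For real `w` the integral converges because its value, a sum of positive terms, is not zero;
  -- the norm of the integrand only depends on the real part of `w`.
  have hreal : IntegrableOn
      (fun t : ℝ => (t : ℂ) ^ n * (exp (-((w.re : ℂ) * t)) / (1 - exp (-(p * t))))) (Ioi 0) := by
    refine .of_integral_ne_zero fun h0 => ?_
    have hsum := hasSum_factorial_div_add_mul_natCast_pow hn (w := w.re) (by rwa [ofReal_re]) hp
    rw [h0] at hsum
    have hsum_re : HasSum (fun k : ℕ => (n.factorial : ℝ) / (w.re + p * k) ^ (n + 1)) 0 :=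
      hasSum_ofReal.1 (by push_cast; exact hsum)
    have hterm := (hasSum_zero_iff_of_nonneg fun k => by positivity).1 hsum_re
    have hpos : 0 < (n.factorial : ℝ) / (w.re + p * (0 : ℕ)) ^ (n + 1) := by positivity
    exact hpos.ne' (congrFun hterm 0)
  refine Integrable.mono hreal (Measurable.aestronglyMeasurable (by fun_prop)) <|
    .of_forall fun t => ?_
  simp only [norm_mul, norm_div, norm_exp_neg_mul_ofReal, ofReal_re, le_refl]

theorem I_pow_mul_pow_mul_exp_neg_sub_mul_I_im (n : ℕ) (c x t u : ℝ) :
    (I ^ n * ((t : ℂ) ^ n * (exp (-((c - x * I) * t)) / u))).im =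
      Real.sin (x * t + Real.pi * n / 2) * (t ^ n * (Real.exp (-(c * t)) / u)) := by
  have hexp : I ^ n * exp (-((c - x * I) * t)) =
      Real.exp (-(c * t)) * exp ((x * t + Real.pi * n / 2 : ℝ) * I) := by
    nth_rw 1 [← exp_pi_div_two_mul_I]
    rw [← exp_nat_mul, ofReal_exp, ← exp_add, ← exp_add]
    push_cast
    ring_nf
  have hpolar : I ^ n * ((t : ℂ) ^ n * (exp (-((c - x * I) * t)) / u)) =
      (t ^ n * (Real.exp (-(c * t)) / u) : ℝ) *
        exp ((x * t + Real.pi * n / 2 : ℝ) * I) := by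
    push_cast at hexp ⊢
    linear_combination (t : ℂ) ^ n / u * hexp
  rw [hpolar, im_ofReal_mul, exp_ofReal_mul_I_im, mul_comm]

theorem I_pow_mul_div_sub_mul_I_pow_im (n : ℕ) (x c r : ℝ) :
    (I ^ n * ((r : ℂ) / (c - x * I) ^ (n + 1))).im =
      (-1) ^ n * ((r : ℂ) / (x + c * I) ^ (n + 1)).re := by
  have hrot : (c - x * I : ℂ) = (x + c * I) / I := by
    rw [div_I]
    linear_combination (c : ℂ) * I_mul_I
  have hI : I ^ n * I ^ n = ((-1) ^ n : ℝ) := by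
    rw [← mul_pow, I_mul_I, ofReal_pow, ofReal_neg, ofReal_one]
  have hfactor : I ^ n * ((r : ℂ) / (c - x * I) ^ (n + 1)) =
      ((-1) ^ n : ℝ) * (I * (r / (x + c * I) ^ (n + 1))) := by
    rw [hrot, div_pow, div_div_eq_mul_div, pow_succ I, ← hI]
    ring
  rw [hfactor, im_ofReal_mul, I_mul_im]

theorem integrableOn_sin_mul_pow_mul_exp_neg_div_one_sub_exp_neg {n : ℕ} (hn : 1 ≤ n) (x : ℝ)
    {c p : ℝ} (hc : 0 < c) (hp : 0 < p) :
    IntegrableOn (fun t : ℝ => Real.sin (x * t + Real.pi * n / 2) *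
      (t ^ n * (Real.exp (-(c * t)) / (1 - Real.exp (-(p * t)))))) (Ioi 0) := by
  have h := ((integrableOn_pow_mul_exp_neg_div_one_sub_exp_neg hn
    (w := c - x * I) (by simpa using hc) hp).const_mul (I ^ n)).im
  refine h.congr (.of_forall fun t => ?_)
  simpa using I_pow_mul_pow_mul_exp_neg_sub_mul_I_im n c x t (1 - Real.exp (-(p * t)))

theorem hasSum_re_factorial_div_add_mul_I_pow {n : ℕ} (hn : 1 ≤ n) (x : ℝ) {c p : ℝ} (hc : 0 < c)
    (hp : 0 < p) :
    HasSum (fun k : ℕ => ((n.factorial : ℂ) / (x + (c + p * k : ℝ) * I) ^ (n + 1)).re)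
      ((-1) ^ n * ∫ t in Ioi (0 : ℝ), Real.sin (x * t + Real.pi * n / 2) *
        (t ^ n * (Real.exp (-(c * t)) / (1 - Real.exp (-(p * t)))))) := by
  have hw : 0 < (c - x * I : ℂ).re := by simpa using hc
  have hint := (integrableOn_pow_mul_exp_neg_div_one_sub_exp_neg hn hw hp).const_mul (I ^ n)
  have hsum := (hasSum_im
    ((hasSum_factorial_div_add_mul_natCast_pow hn hw hp).mul_left (I ^ n))).mul_left
      ((-1 : ℝ) ^ n)
  convert! hsum using 1
  · ext k
    have h := I_pow_mul_div_sub_mul_I_pow_im n x (c + p * k) n.factorial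
    have hcomm : (c - x * I + p * k : ℂ) = ((c + p * k : ℝ) : ℂ) - x * I := by
      push_cast
      ring
    rw [ofReal_natCast] at h
    rw [hcomm, h, ← mul_assoc, ← mul_pow, neg_one_mul, neg_neg, one_pow, one_mul]
  · rw [← integral_const_mul (I ^ n)]
    refine congrArg ((-1 : ℝ) ^ n * ·)
      (Eq.trans (integral_congr_ae (.of_forall fun t => ?_)) (integral_im hint))
    simpa using (I_pow_mul_pow_mul_exp_neg_sub_mul_I_im n c x t (1 - Real.exp (-(p * t)))).symm

end LaplaceTransform

section LipschitzSummation

open Complex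

theorem hasSum_int_factorial_div_sub_mul_I_pow {n : ℕ} (hn : 1 ≤ n) {z : ℂ} (hz : 0 < z.re)
    {y : ℝ} (hy : exp z = y) :
    HasSum (fun d : ℤ => (n.factorial : ℂ) / (z - 2 * Real.pi * d * I) ^ (n + 1))
      ((y / (y - 1) * geomPoly n (1 / (y - 1)) : ℝ) : ℂ) := by
  obtain ⟨τ, hτ⟩ : ∃ τ : ℂ, 2 * Real.pi * I * τ = -z :=
    ⟨-z / (2 * Real.pi * I), mul_div_cancel₀ _ two_pi_I_ne_zero⟩
  have him : 0 < τ.im := by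
    have hre : z.re = 2 * Real.pi * τ.im := by simpa using congrArg (-re ·) hτ.symm
    exact pos_of_mul_pos_right (hre ▸ hz) Real.two_pi_pos.le
  have hgeom : ∑' m : ℕ, (m : ℂ) ^ n * exp (2 * Real.pi * I * τ) ^ m =
      ((y / (y - 1) * geomPoly n (1 / (y - 1)) : ℝ) : ℂ) := by
    have hnorm : 1 < |y| := by
      rw [← Real.norm_eq_abs, ← norm_real, ← hy, norm_exp]
      exact Real.one_lt_exp_iff.2 hz
    rw [hτ, exp_neg, hy, ← (hasSum_ofReal.2 (hasSum_pow_mul_inv_pow n hnorm)).tsum_eq]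
    push_cast
    rfl
  have hsummable : Summable fun d : ℤ => 1 / (τ + d) ^ (n + 1) := by
    simpa only [zpow_natCast, Int.cast_one, one_mul, one_div] using
      EisensteinSeries.linear_right_summable τ 1 (k := (n + 1 : ℕ)) (by omega)
  have hlipschitz := hsummable.hasSum.mul_left ((n.factorial : ℂ) / (-2 * Real.pi * I) ^ (n + 1))
  rw [EisensteinSeries.qExpansion_identity hn ⟨τ, him⟩, hgeom, ← mul_assoc,
    div_mul_div_cancel₀ (by simp), div_self (Nat.cast_ne_zero.2 n.factorial_ne_zero),
    one_mul] at hlipschitz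
  refine hlipschitz.congr_fun fun d => ?_
  rw [div_mul_div_comm, mul_one, ← mul_pow]
  congr 2
  linear_combination hτ

theorem div_sub_mul_I_pow_add_div_add_mul_I_pow (n : ℕ) (r x c : ℝ) :
    (r : ℂ) / (x - c * I) ^ n + (r : ℂ) / (x + c * I) ^ n =
      ((2 * ((r : ℂ) / (x + c * I) ^ n).re : ℝ) : ℂ) := by
  rw [← add_conj, add_comm]
  simp [sub_eq_add_neg]

theorem exp_neg_div_one_sub_exp_neg_two_mul (c t : ℝ) :
    Real.exp (-(c * t)) / (1 - Real.exp (-(2 * c * t))) = 2⁻¹ * (1 / Real.sinh (c * t)) := by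
  have hfactor : 1 - Real.exp (-(2 * c * t)) =
      Real.exp (-(c * t)) * (2 * Real.sinh (c * t)) := by
    rw [Real.sinh_eq, mul_div_cancel₀ _ two_ne_zero, mul_sub, ← Real.exp_add, ← Real.exp_add,
      neg_add_cancel, Real.exp_zero]
    ring_nf
  rw [hfactor, ← div_div, div_self (Real.exp_ne_zero _), ← one_div_mul_one_div, one_div 2]

theorem exp_neg_div_one_sub_exp_neg (u : ℝ) :
    Real.exp (-u) / (1 - Real.exp (-u)) = 1 / (Real.exp u - 1) := by
  have hfactor : 1 - Real.exp (-u) = Real.exp (-u) * (Real.exp u - 1) := by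
    rw [mul_sub, ← Real.exp_add, neg_add_cancel, Real.exp_zero, mul_one]
  rw [hfactor, ← div_div, div_self (Real.exp_ne_zero _)]

theorem integrableOn_sin_mul_pow_div_sinh {n : ℕ} (hn : 1 ≤ n) (x : ℝ) :
    IntegrableOn (fun t : ℝ =>
      Real.sin (x * t + Real.pi * n / 2) * (t ^ n / Real.sinh (Real.pi * t))) (Ioi 0) := by
  have h := (integrableOn_sin_mul_pow_mul_exp_neg_div_one_sub_exp_neg hn x Real.pi_pos
    Real.two_pi_pos).const_mul 2
  simp only [exp_neg_div_one_sub_exp_neg_two_mul, mul_left_comm _ (2⁻¹ : ℝ)] at h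
  simpa only [IntegrableOn, mul_one_div, inv_mul_cancel_left₀ (two_ne_zero (α := ℝ))] using h

theorem integrableOn_sin_mul_pow_div_exp_sub_one {n : ℕ} (hn : 1 ≤ n) (x : ℝ) :
    IntegrableOn (fun t : ℝ =>
      Real.sin (x * t + Real.pi * n / 2) * (t ^ n / (Real.exp (2 * Real.pi * t) - 1)))
      (Ioi 0) := by
  simpa only [exp_neg_div_one_sub_exp_neg, mul_one_div] using
    integrableOn_sin_mul_pow_mul_exp_neg_div_one_sub_exp_neg hn x Real.two_pi_pos Real.two_pi_pos

theorem hasSum_two_mul_re_factorial_div_add_odd_mul_pi_mul_I_pow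
    {n : ℕ} (hn : 1 ≤ n) (x : ℝ) :
    HasSum
      (fun k : ℕ => 2 * ((n.factorial : ℂ) /
        (x + (Real.pi + 2 * Real.pi * k : ℝ) * I) ^ (n + 1)).re)
      ((-1) ^ n * ∫ t in Ioi (0 : ℝ),
        Real.sin (x * t + Real.pi * n / 2) * (t ^ n / Real.sinh (Real.pi * t))) := by
  have h := (hasSum_re_factorial_div_add_mul_I_pow hn x Real.pi_pos Real.two_pi_pos).mul_left 2
  simp only [exp_neg_div_one_sub_exp_neg_two_mul, mul_left_comm _ (2⁻¹ : ℝ)] at h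
  simpa only [integral_const_mul, mul_left_comm _ (2⁻¹ : ℝ), mul_one_div,
    inv_mul_cancel_left₀ (two_ne_zero (α := ℝ))] using h

theorem hasSum_two_mul_re_factorial_div_add_even_mul_pi_mul_I_pow
    {n : ℕ} (hn : 1 ≤ n) (x : ℝ) :
    HasSum
      (fun k : ℕ => 2 * ((n.factorial : ℂ) /
        (x + (2 * Real.pi + 2 * Real.pi * k : ℝ) * I) ^ (n + 1)).re)
      (2 * (-1) ^ n * ∫ t in Ioi (0 : ℝ),
        Real.sin (x * t + Real.pi * n / 2) * (t ^ n / (Real.exp (2 * Real.pi * t) - 1))) := by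
  simpa only [exp_neg_div_one_sub_exp_neg, mul_one_div, mul_assoc] using
    (hasSum_re_factorial_div_add_mul_I_pow hn x Real.two_pi_pos Real.two_pi_pos).mul_left 2

theorem geomPoly_neg_one_div_exp_add_one_eq_integral {n : ℕ} (hn : 1 ≤ n) {x : ℝ} (hx : 0 < x) :
    Real.exp x / (Real.exp x + 1) * geomPoly n (-1 / (Real.exp x + 1)) =
      (-1) ^ n * ∫ t in Ioi (0 : ℝ),
        Real.sin (x * t + Real.pi * n / 2) * (t ^ n / Real.sinh (Real.pi * t)) := by
  have hexp : exp (x - Real.pi * I) = ((-Real.exp x : ℝ) : ℂ) := by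
    rw [exp_sub, exp_pi_mul_I, div_neg, div_one, ofReal_neg, ofReal_exp]
  have hlipschitz := (hasSum_int_factorial_div_sub_mul_I_pow hn (by simpa using hx)
    hexp).nat_add_neg_add_one
  have hsine := hasSum_ofReal.2 (hasSum_two_mul_re_factorial_div_add_odd_mul_pi_mul_I_pow hn x)
  have hpair (k : ℕ) :
      (n.factorial : ℂ) / (x - Real.pi * I - 2 * Real.pi * (k : ℤ) * I) ^ (n + 1) +
        n.factorial / (x - Real.pi * I - 2 * Real.pi * (-((k : ℤ) + 1) : ℤ) * I) ^ (n + 1) =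
      ((2 * ((n.factorial : ℂ) /
        (x + (Real.pi + 2 * Real.pi * k : ℝ) * I) ^ (n + 1)).re : ℝ) : ℂ) := by
    rw [← ofReal_natCast n.factorial, ← div_sub_mul_I_pow_add_div_add_mul_I_pow]
    congr 3 <;> push_cast <;> ring
  simp only [hpair] at hlipschitz
  rw [← ofReal_injective (hlipschitz.unique hsine), ← neg_add', neg_div_neg_eq,
    one_div_neg_eq_neg_one_div, neg_div]

theorem geomPoly_one_div_exp_sub_one_eq_add_integral {n : ℕ} (hn : 1 ≤ n) {x : ℝ} (hx : 0 < x) :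
    Real.exp x / (Real.exp x - 1) * geomPoly n (1 / (Real.exp x - 1)) =
      n.factorial / x ^ (n + 1) +
        2 * (-1) ^ n * ∫ t in Ioi (0 : ℝ),
          Real.sin (x * t + Real.pi * n / 2) * (t ^ n / (Real.exp (2 * Real.pi * t) - 1)) := by
  have hlipschitz := (hasSum_nat_add_iff' 1).2 (hasSum_int_factorial_div_sub_mul_I_pow hn
    (z := x) (by simpa using hx) (ofReal_exp x).symm).nat_add_neg
  have hsine := hasSum_ofReal.2 (hasSum_two_mul_re_factorial_div_add_even_mul_pi_mul_I_pow hn x)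
  have hpair (k : ℕ) :
      (n.factorial : ℂ) / (x - 2 * Real.pi * ((k + 1 : ℕ) : ℤ) * I) ^ (n + 1) +
        n.factorial / (x - 2 * Real.pi * (-((k + 1 : ℕ) : ℤ) : ℤ) * I) ^ (n + 1) =
      ((2 * ((n.factorial : ℂ) /
        (x + (2 * Real.pi + 2 * Real.pi * k : ℝ) * I) ^ (n + 1)).re : ℝ) : ℂ) := by
    rw [← ofReal_natCast n.factorial, ← div_sub_mul_I_pow_add_div_add_mul_I_pow]
    congr 3 <;> push_cast <;> ring
  simp only [hpair] at hlipschitz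
  have hsum := hlipschitz.unique hsine
  apply ofReal_injective
  rw [ofReal_add, ← hsum]
  simp

end LipschitzSummation

theorem mainTheorem7_general :
    (∀ (n : ℕ) (r x a : ℝ), 0 < x → 0 < a → a < r →
      Complex.VerticalIntegrable (fun s : ℂ =>
        (x : ℂ) ^ (-s) * s ^ n * Complex.Gamma s * Complex.Gamma ((r : ℂ) - s)) a ∧
      ((1 / (1 + x) ^ r * genGeomPoly n r (-x / (1 + x)) : ℝ) : ℂ) =
        (-1) ^ n / (2 * (Real.pi : ℂ) * Complex.I * Complex.Gamma (r : ℂ)) *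
          vertLineIntegral a (fun s : ℂ =>
            (x : ℂ) ^ (-s) * s ^ n * Complex.Gamma s * Complex.Gamma ((r : ℂ) - s))) ∧
    (∀ (n : ℕ) (x a : ℝ), 0 < x → (n : ℝ) + 1 < a →
      Complex.VerticalIntegrable (fun s : ℂ =>
        (x : ℂ) ^ (-s) * riemannZeta (s - (n : ℂ)) * Complex.Gamma s) a ∧
      ((Real.exp x / (Real.exp x - 1) * geomPoly n (1 / (Real.exp x - 1)) : ℝ) : ℂ) =
        (if n = 0 then 1 else 0) +
          1 / (2 * (Real.pi : ℂ) * Complex.I) *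
            vertLineIntegral a (fun s : ℂ =>
              (x : ℂ) ^ (-s) * riemannZeta (s - (n : ℂ)) * Complex.Gamma s)) ∧
    (∀ (n : ℕ) (x : ℝ), 1 ≤ n → 0 < x →
      IntegrableOn (fun t : ℝ =>
        Real.sin (x * t + Real.pi * n / 2) * (t ^ n / Real.sinh (Real.pi * t))) (Ioi 0) ∧
      Real.exp x / (Real.exp x + 1) * geomPoly n (-1 / (Real.exp x + 1)) =
        (-1) ^ n * ∫ t in Ioi (0 : ℝ),
          Real.sin (x * t + Real.pi * n / 2) * (t ^ n / Real.sinh (Real.pi * t))) ∧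
    (∀ (n : ℕ) (x : ℝ), 1 ≤ n → 0 < x →
      IntegrableOn (fun t : ℝ =>
        Real.sin (x * t + Real.pi * n / 2) * (t ^ n / (Real.exp (2 * Real.pi * t) - 1)))
        (Ioi 0) ∧
      Real.exp x / (Real.exp x - 1) * geomPoly n (1 / (Real.exp x - 1)) =
        (Nat.factorial n : ℝ) / x ^ (n + 1) +
          2 * (-1) ^ n * ∫ t in Ioi (0 : ℝ),
            Real.sin (x * t + Real.pi * n / 2) *
              (t ^ n / (Real.exp (2 * Real.pi * t) - 1))) := by
  exact ⟨fun n _ _ _ hx ha har =>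
      ⟨verticalIntegrable_cpow_neg_mul_pow_mul_Gamma_mul_Gamma_sub n hx ha har,
        genGeomPoly_eq_vertLineIntegral n hx ha har⟩,
    fun n _ _ hx ha =>
      ⟨verticalIntegrable_cpow_neg_mul_riemannZeta_sub_mul_Gamma n hx ha,
        geomPoly_eq_vertLineIntegral_riemannZeta n hx ha⟩,
    fun _ x hn hx =>
      ⟨integrableOn_sin_mul_pow_div_sinh hn x,
        geomPoly_neg_one_div_exp_add_one_eq_integral hn hx⟩,
    fun _ x hn hx =>
      ⟨integrableOn_sin_mul_pow_div_exp_sub_one hn x,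
        geomPoly_one_div_exp_sub_one_eq_add_integral hn hx⟩⟩

theorem mainTheorem7 :
    (∀ (n : ℕ) (r x a : ℝ), 0 ≤ r → 0 < x → x < 1 → 0 < a → a < 1 →
      Complex.VerticalIntegrable (fun s : ℂ =>
        (x : ℂ) ^ (-s) * s ^ n * Complex.Gamma s * Complex.Gamma ((r : ℂ) + 1 - s)) a ∧
      ((1 / (1 + x) ^ (r + 1) * genGeomPoly n (r + 1) (-x / (1 + x)) : ℝ) : ℂ) =
        (-1) ^ n / (2 * (Real.pi : ℂ) * Complex.I * Complex.Gamma ((r : ℂ) + 1)) *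
          vertLineIntegral a (fun s : ℂ =>
            (x : ℂ) ^ (-s) * s ^ n * Complex.Gamma s * Complex.Gamma ((r : ℂ) + 1 - s))) ∧
    (∀ (n : ℕ) (x a : ℝ), 0 < x → (n : ℝ) + 1 < a →
      Complex.VerticalIntegrable (fun s : ℂ =>
        (x : ℂ) ^ (-s) * riemannZeta (s - (n : ℂ)) * Complex.Gamma s) a ∧
      ((Real.exp x / (Real.exp x - 1) * geomPoly n (1 / (Real.exp x - 1)) : ℝ) : ℂ) =
        (if n = 0 then 1 else 0) +
          1 / (2 * (Real.pi : ℂ) * Complex.I) *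
            vertLineIntegral a (fun s : ℂ =>
              (x : ℂ) ^ (-s) * riemannZeta (s - (n : ℂ)) * Complex.Gamma s)) ∧
    (∀ (n : ℕ) (x : ℝ), 1 ≤ n → 0 < x →
      IntegrableOn (fun t : ℝ =>
        Real.sin (x * t + Real.pi * n / 2) * (t ^ n / Real.sinh (Real.pi * t))) (Ioi 0) ∧
      Real.exp x / (Real.exp x + 1) * geomPoly n (-1 / (Real.exp x + 1)) =
        (-1) ^ n * ∫ t in Ioi (0 : ℝ),
          Real.sin (x * t + Real.pi * n / 2) * (t ^ n / Real.sinh (Real.pi * t))) ∧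
    (∀ (n : ℕ) (x : ℝ), 1 ≤ n → 0 < x →
      IntegrableOn (fun t : ℝ =>
        Real.sin (x * t + Real.pi * n / 2) * (t ^ n / (Real.exp (2 * Real.pi * t) - 1)))
        (Ioi 0) ∧
      Real.exp x / (Real.exp x - 1) * geomPoly n (1 / (Real.exp x - 1)) =
        (Nat.factorial n : ℝ) / x ^ (n + 1) +
          2 * (-1) ^ n * ∫ t in Ioi (0 : ℝ),
            Real.sin (x * t + Real.pi * n / 2) *
              (t ^ n / (Real.exp (2 * Real.pi * t) - 1))) := by
  refine ⟨fun n r x a hr hx _ ha ha1 => ?_, mainTheorem7_general.2⟩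
  simpa only [Complex.ofReal_add r 1, Complex.ofReal_one] using
    mainTheorem7_general.1 n (r + 1) x a hx ha (by linarith)
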